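/- **Conventions.** For a bounded operator $T$ on a complex Hilbert space $\mathcal H$, let $T=V|T|$ be its polar decomposition ($|T|=(T^*T)^{1/2}$, $V$ a partial isometry with $\ker V=\ker T$); its Aluthge transform is $\widetilde T=|T|^{1/2}V|T|^{1/2}$, and the toral Aluthge transform of a pair is $\widetilde{(T_1,T_2)}=(\widetilde T_1,\widetilde T_2)$. A pair $(T_1,T_2)$ is (jointly) hyponormal if the operator matrix with $(i,j)$ entry $[T_j^*,T_i]=T_j^*T_i-T_iT_j^*$ is positive on $\mathcal H\oplus\mathcal H$, and subnormal if it is the restriction of a commuting pair of normal operators to a common invariant subspace; a single operator $T$ is hyponormal if $T^*T\ge TT^*$, and subnormal if it is the restriction of a normal operator to an invariant subspace. For bounded positive weights $\alpha,\beta:\mathbb Z_+^2\to(0,\infty)$, the 2-variable weighted shift $W_{(\alpha,\beta)}=(T_1,T_2)$ on $\ell^2(\mathbb Z_+^2)$ is $T_1e_{\mathbf k}=\alpha_{\mathbf k}e_{\mathbf k+(1,0)}$, $T_2e_{\mathbf k}=\beta_{\mathbf k}e_{\mathbf k+(0,1)}$. For a bounded sequence $\omega$ of positive weights, $W_\omega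 e_n=\omega_ne_{n+1}$ on $\ell^2(\mathbb Z_+)$; a Berger measure of $W_\omega$ is a Borel probability measure $\xi$ on $[0,\|W_\omega\|^2]$ with $\omega_0^2\cdots\omega_{k-1}^2=\int s^k\,d\xi(s)$ for all $k\ge0$. **Theorem.** Let $\omega=(\omega_0,\omega_1,\dots)$ be a bounded sequence of positive weights such that $W_\omega$ has a Berger measure $\xi$ with $\frac1s\in L^1(\xi)$ (in particular $\xi(\{0\})=0$), and put $\rho=\int\frac1s\,d\xi(s)$. For $x_0,a>0$ let $W_{(\alpha,\beta)}$ be the 2-variable weighted shift with $\alpha_{(0,0)}=x_0$, $\alpha_{(0,k_2)}=a$ for $k_2\ge1$, $\alpha_{(k_1,k_2)}=\omega_{k_1-1}$ for $k_1\ge1$, $k_2\ge0$, and $\beta_{(k_1,k_2)}=\alpha_{(k_2,k_1)}$. (So its core is of tensor form with Berger measure $\xi\times\xi$, and its zeroth and first rows are the backward extensions $[x_0,\xi]=\mathrm{shift}(x_0,\omega_0,\omega_1,\dots)$ and $[a,\xi]=\mathrm{shift}(a,\omega_0,\omega_1,\dots)$.) Assume $$\omega_1^2\rho<2.$$ Then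 there exist $x_0>0$ and $a>0$ with $$\frac{\omega_1^2}{4}<x_0^2\le\frac1{2\rho},\qquad a<2x_0-\omega_1, \tag{$*$}$$ and for all $x_0,a>0$ satisfying $(*)$: the shifts $[x_0,\xi]$ and $[a,\xi]$ are subnormal; $W_{(\alpha,\beta)}$ is commuting and (i) $W_{(\alpha,\beta)}$ is subnormal; and (ii) the toral Aluthge transform $\widetilde W_{(\alpha,\beta)}$ is commuting but not (jointly) hyponormal. Consequently the toral Aluthge transform does not preserve hyponormality: there is a commuting, subnormal and (jointly) hyponormal 2-variable weighted shift whose toral Aluthge transform is commuting but not (jointly) hyponormal. By contrast, in one variable, if $W_\omega$ (with bounded positive weights) is hyponormal, then so is its Aluthge transform $\widetilde W_\omega$. -/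

import Mathlib

open MeasureTheory
open scoped ComplexOrder

namespace AluthgeShift

noncomputable section

/-! ### Aluthge transform of a bounded operator -/

section Operators

universe u

variable {H : Type u} [NormedAddCommGroup H] [InnerProductSpace ℂ H] [CompleteSpace H]

/-- The modulus `|T| = (T* T)^(1/2)`. -/
def modulus (T : H →L[ℂ] H) : H →L[ℂ] H := CFC.sqrt (star T * T)

/-- `T = V |T|` is the polar decomposition of `T`: here `V` is a partial isometry (isometric on
the orthogonal complement of its kernel) with `ker V = ker T`. -/
structure IsPolarFactor (T V : H →L[ℂ] H) : Prop where
  partial_isometry : ∀ x ∈ (LinearMap.ker (V : H →ₗ[ℂ] H))ᗮ, ‖V x‖ = ‖x‖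
  ker_eq : LinearMap.ker (V : H →ₗ[ℂ] H) = LinearMap.ker (T : H →ₗ[ℂ] H)
  eq_mul : T = V * modulus T

theorem modulus_nonneg (T : H →L[ℂ] H) : 0 ≤ modulus T := CFC.sqrt_nonneg _

theorem modulus_mul_self (T : H →L[ℂ] H) : modulus T * modulus T = star T * T :=
  CFC.sqrt_mul_sqrt_self _ (star_mul_self_nonneg T)

theorem star_modulus (T : H →L[ℂ] H) : star (modulus T) = modulus T :=
  (IsSelfAdjoint.of_nonneg (modulus_nonneg T)).star_eq

theorem norm_modulus_apply (T : H →L[ℂ] H) (x : H) : ‖modulus T x‖ = ‖T x‖ := by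
  have h1 : inner ℂ (modulus T x) (modulus T x) = inner ℂ (T x) (T x) := by
    have e1 : inner ℂ (modulus T x) (modulus T x) = inner ℂ x (star (modulus T) (modulus T x)) := by
      rw [ContinuousLinearMap.star_eq_adjoint, ContinuousLinearMap.adjoint_inner_right]
    have e2 : inner ℂ (T x) (T x) = inner ℂ x (star T (T x)) := by
      rw [ContinuousLinearMap.star_eq_adjoint, ContinuousLinearMap.adjoint_inner_right]
    rw [e1, e2, star_modulus, ← mul_apply_eq_comp, modulus_mul_self,
      mul_apply_eq_comp]
  rw [inner_self_eq_norm_sq_to_K, inner_self_eq_norm_sq_to_K] at h1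
  have h2 : ‖modulus T x‖ ^ 2 = ‖T x‖ ^ 2 := by exact_mod_cast h1
  exact (sq_eq_sq₀ (norm_nonneg _) (norm_nonneg _)).1 h2

/-- The closure of the range of `|T|`. -/
def modulusRange (T : H →L[ℂ] H) : Submodule ℂ H :=
  (LinearMap.range (modulus T : H →ₗ[ℂ] H)).topologicalClosure

instance (T : H →L[ℂ] H) : CompleteSpace (modulusRange T) :=
  (Submodule.isClosed_topologicalClosure _).completeSpace_coe

theorem modulusRange_orthogonal (T : H →L[ℂ] H) :
    (modulusRange T)ᗮ = LinearMap.ker (T : H →ₗ[ℂ] H) := by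
  ext x
  rw [modulusRange, Submodule.orthogonal_closure, Submodule.mem_orthogonal, LinearMap.mem_ker]
  have key : ∀ y, inner ℂ (modulus T y) x = inner ℂ y (modulus T x) := fun y => by
    conv_rhs => rw [← star_modulus T, ContinuousLinearMap.star_eq_adjoint,
      ContinuousLinearMap.adjoint_inner_right]
  have hz : T x = 0 ↔ modulus T x = 0 := by
    rw [← norm_eq_zero, ← norm_modulus_apply, norm_eq_zero]
  constructor
  · intro h
    refine hz.2 (inner_self_eq_zero (𝕜 := ℂ).1 ?_)
    rw [← key]
    exact h _ ⟨_, rfl⟩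
  · rintro h _ ⟨y, rfl⟩
    have := hz.1 h
    change inner ℂ (modulus T y) x = 0
    rw [key, this, inner_zero_right]

/-- Existence and uniqueness of the polar decomposition. -/
theorem existsUnique_polarFactor (T : H →L[ℂ] H) : ∃! V, IsPolarFactor T V := by
  set K := modulusRange T with hK
  let e : H →ₗ[ℂ] K := (modulus T : H →ₗ[ℂ] H).codRestrict K
    (fun x => Submodule.le_topologicalClosure _ ⟨x, rfl⟩)
  have he : DenseRange e := by
    intro y
    rw [closure_subtype]
    have : ((↑) '' Set.range e : Set H) = (LinearMap.range (modulus T : H →ₗ[ℂ] H) : Set H) := by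
      ext z
      constructor
      · rintro ⟨_, ⟨x, rfl⟩, rfl⟩
        exact ⟨x, rfl⟩
      · rintro ⟨x, rfl⟩
        exact ⟨_, ⟨x, rfl⟩, rfl⟩
    rw [this]
    exact y.2
  have hnorm : ∀ x, ‖(T : H →ₗ[ℂ] H) x‖ ≤ 1 * ‖e x‖ := fun x => by
    rw [one_mul]
    exact (norm_modulus_apply T x).ge
  let W : K →L[ℂ] H := (T : H →ₗ[ℂ] H).extendOfNorm e
  have hWe : ∀ x, W (e x) = T x := fun x => LinearMap.extendOfNorm_eq he ⟨1, hnorm⟩ x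
  have hW : ∀ y, ‖W y‖ = ‖y‖ := by
    refine fun y => he.induction_on (p := fun y => ‖W y‖ = ‖y‖) y
      (isClosed_eq (by fun_prop) (by fun_prop)) fun x => ?_
    rw [hWe]
    exact (norm_modulus_apply T x).symm
  let V : H →L[ℂ] H := W ∘L K.orthogonalProjectionOnto
  have hVK : ∀ y : K, V y = W y := fun y => by
    simp [V]
  have hker : LinearMap.ker (V : H →ₗ[ℂ] H) = LinearMap.ker (T : H →ₗ[ℂ] H) := by
    rw [← modulusRange_orthogonal T]
    ext x
    have : V x = 0 ↔ K.orthogonalProjectionOnto x = 0 := by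
      rw [← norm_eq_zero, ← norm_eq_zero (a := K.orthogonalProjectionOnto x), ← hW]
      rfl
    rw [LinearMap.mem_ker]
    exact this.trans Submodule.orthogonalProjectionOnto_eq_zero_iff
  refine ⟨V, ⟨?_, hker, ?_⟩, ?_⟩
  · intro x hx
    rw [hker, ← modulusRange_orthogonal, Submodule.orthogonal_orthogonal] at hx
    have := hVK ⟨x, hx⟩
    rw [this, hW]
    rfl
  · ext x
    rw [mul_apply_eq_comp]
    exact ((hVK (e x)).trans (hWe x)).symm
  · intro V' hV'
    have hEq : ∀ x ∈ K, V' x = V x := by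
      intro x hx
      have : ∀ y : K, V' y = V y := fun y => he.induction_on (p := fun y : K => V' y = V y) y
        (isClosed_eq (by fun_prop) (by fun_prop)) fun z => by
          rw [hVK, hWe]
          conv_rhs => rw [hV'.eq_mul]
          rfl
      exact this ⟨x, hx⟩
    ext x
    obtain ⟨y, hy, z, hz, rfl⟩ := Submodule.exists_add_mem_mem_orthogonal (K := K) x
    rw [modulusRange_orthogonal] at hz
    have h1 : V' z = 0 := by
      have : z ∈ LinearMap.ker (V' : H →ₗ[ℂ] H) := hV'.ker_eq ▸ hz
      exact this
    have h2 : V z = 0 := by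
      have : z ∈ LinearMap.ker (V : H →ₗ[ℂ] H) := hker ▸ hz
      exact this
    rw [map_add, map_add, h1, h2, hEq y hy]

/-- The partial isometry `V` of the polar decomposition `T = V |T|`. -/
def polarFactor (T : H →L[ℂ] H) : H →L[ℂ] H := (existsUnique_polarFactor T).choose

theorem isPolarFactor_polarFactor (T : H →L[ℂ] H) : IsPolarFactor T (polarFactor T) :=
  (existsUnique_polarFactor T).choose_spec.1

/-- The (one-variable) Aluthge transform `|T|^(1/2) V |T|^(1/2)`. -/
def aluthge (T : H →L[ℂ] H) : H →L[ℂ] H :=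
  CFC.sqrt (modulus T) * polarFactor T * CFC.sqrt (modulus T)

/-- The toral Aluthge transform of a tuple: the Aluthge transform of each coordinate. -/
def toralAluthge {n : ℕ} (T : Fin n → (H →L[ℂ] H)) : Fin n → (H →L[ℂ] H) :=
  fun i => aluthge (T i)

/-! ### Hyponormality and subnormality -/

/-- A single operator is hyponormal if `T T* ≤ T* T`. -/
def IsHyponormal (T : H →L[ℂ] H) : Prop := T * star T ≤ star T * T

/-- A tuple is (jointly) hyponormal if the operator matrix with `(i, j)` entry
`[T_j*, T_i] = T_j* T_i - T_i T_j*` is positive on the direct sum of `n` copies of `H`. -/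
def IsJointlyHyponormal {n : ℕ} (T : Fin n → (H →L[ℂ] H)) : Prop :=
  ∀ x : Fin n → H,
    0 ≤ ∑ i, ∑ j, inner ℂ (x i) ((star (T j) * T i - T i * star (T j)) (x j))

/-- A tuple is normal if it is commuting and consists of normal operators. -/
def IsNormalTuple {n : ℕ} (N : Fin n → (H →L[ℂ] H)) : Prop :=
  (∀ i j, Commute (N i) (N j)) ∧ ∀ i, IsStarNormal (N i)

/-- A tuple is subnormal if it is (up to the isometric embedding `J`) the restriction of a normal
tuple to a common invariant subspace. -/
def IsSubnormalTuple {n : ℕ} (T : Fin n → (H →L[ℂ] H)) : Prop :=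
  ∃ (K : Type u) (_ : NormedAddCommGroup K) (_ : InnerProductSpace ℂ K) (_ : CompleteSpace K)
    (N : Fin n → (K →L[ℂ] K)) (J : H →ₗᵢ[ℂ] K),
    IsNormalTuple N ∧ ∀ i x, N i (J x) = J (T i x)

/-- A single operator is subnormal if it has a normal extension. -/
def IsSubnormal (T : H →L[ℂ] H) : Prop := IsSubnormalTuple ![T]

end Operators

/-! ### Weighted shifts -/

/-- The complex Hilbert space of square-summable families indexed by `ι`. -/
abbrev Ell2 (ι : Type) : Type := lp (fun _ : ι => ℂ) 2

/-- The canonical orthonormal basis vector `e_i`. -/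
def basisVec {ι : Type} [DecidableEq ι] (i : ι) : Ell2 ι := lp.single 2 i (1 : ℂ)

theorem weighted_bound {ι : Type} {τ : ι → ι} (hτ : Function.Injective τ) {w : ι → ℝ} {C : ℝ}
    (hC : ∀ i, |w i| ≤ C) (f : Ell2 ι) (s : Finset ι) :
    ∑ j ∈ s, ‖Function.extend τ (fun i => (w i : ℂ) * f i) 0 j‖ ^ (2 : ENNReal).toReal ≤
      (|C| * ‖f‖) ^ (2 : ENNReal).toReal := by
  classical
  have h2 : (0 : ℝ) < (2 : ENNReal).toReal := by norm_num
  calc ∑ j ∈ s, ‖Function.extend τ (fun i => (w i : ℂ) * f i) 0 j‖ ^ (2 : ENNReal).toReal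
      ≤ ∑ j ∈ (s.preimage τ hτ.injOn).image τ,
          ‖Function.extend τ (fun i => (w i : ℂ) * f i) 0 j‖ ^ (2 : ENNReal).toReal := by
        rw [Finset.image_preimage, Finset.sum_filter]
        refine Finset.sum_le_sum fun j _ => ?_
        split_ifs with h
        · exact le_rfl
        · rw [Function.extend_apply' _ _ _ (by simpa using h)]
          simp
    _ = ∑ i ∈ s.preimage τ hτ.injOn, ‖(w i : ℂ) * f i‖ ^ (2 : ENNReal).toReal := by
        rw [Finset.sum_image hτ.injOn]
        exact Finset.sum_congr rfl fun i _ => by rw [hτ.extend_apply]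
    _ ≤ ∑ i ∈ s.preimage τ hτ.injOn,
          |C| ^ (2 : ENNReal).toReal * ‖f i‖ ^ (2 : ENNReal).toReal := by
        refine Finset.sum_le_sum fun i _ => ?_
        rw [← Real.mul_rpow (abs_nonneg _) (norm_nonneg _), norm_mul, Complex.norm_real,
          Real.norm_eq_abs]
        have := (hC i).trans (le_abs_self C)
        gcongr
    _ ≤ (|C| * ‖f‖) ^ (2 : ENNReal).toReal := by
        rw [← Finset.mul_sum, Real.mul_rpow (abs_nonneg _) (norm_nonneg _)]
        gcongr
        exact lp.sum_rpow_le_norm_rpow h2 f _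

open Classical in
/-- For an injective `τ : ι → ι` and bounded weights `w`, the bounded operator on `ℓ²(ι)` with
`e_i ↦ w i • e_(τ i)` for all `i`. (The value is `0` if `τ` is not injective or `w` is not bounded,
which never occurs below.) -/
def weightedTranslation {ι : Type} (τ : ι → ι) (w : ι → ℝ) : Ell2 ι →L[ℂ] Ell2 ι :=
  if h : Function.Injective τ ∧ ∃ C, ∀ i, |w i| ≤ C then
    LinearMap.mkContinuous
      { toFun := fun f => ⟨Function.extend τ (fun i => (w i : ℂ) * f i) 0,
          memℓp_gen' (weighted_bound h.1 h.2.choose_spec f)⟩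
        map_add' := fun f g => by
          ext j
          change Function.extend τ (fun i => (w i : ℂ) * (f i + g i)) 0 j =
            Function.extend τ (fun i => (w i : ℂ) * f i) 0 j +
              Function.extend τ (fun i => (w i : ℂ) * g i) 0 j
          by_cases hj : ∃ i, τ i = j
          · obtain ⟨i, rfl⟩ := hj
            simp [h.1.extend_apply, mul_add]
          · simp [Function.extend_apply' _ _ _ hj]
        map_smul' := fun c f => by
          ext j
          by_cases hj : ∃ i, τ i = j
          · obtain ⟨i, rfl⟩ := hj
            simp [h.1.extend_apply, mul_left_comm]
          · simp [Function.extend_apply' _ _ _ hj] }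
      |h.2.choose|
      (fun f => lp.norm_le_of_forall_sum_le (by norm_num) (by positivity)
        (weighted_bound h.1 h.2.choose_spec f))
  else 0

theorem weightedTranslation_apply {ι : Type} {τ : ι → ι} (hτ : Function.Injective τ) {w : ι → ℝ}
    (hw : ∃ C, ∀ i, |w i| ≤ C) (f : Ell2 ι) (j : ι) :
    weightedTranslation τ w f j = Function.extend τ (fun i => (w i : ℂ) * f i) 0 j := by
  rw [weightedTranslation, dif_pos ⟨hτ, hw⟩]
  rfl

theorem weightedTranslation_basisVec {ι : Type} [DecidableEq ι] {τ : ι → ι}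
    (hτ : Function.Injective τ) {w : ι → ℝ} (hw : ∃ C, ∀ i, |w i| ≤ C) (i : ι) :
    weightedTranslation τ w (basisVec i) = (w i : ℂ) • basisVec (τ i) := by
  ext j
  rw [weightedTranslation_apply hτ hw]
  by_cases hj : ∃ k, τ k = j
  · obtain ⟨k, rfl⟩ := hj
    rw [hτ.extend_apply]
    by_cases hk : k = i
    · subst hk
      simp [basisVec, -Complex.coe_smul]
    · have : τ k ≠ τ i := fun h => hk (hτ h)
      simp [basisVec, hk, this, -Complex.coe_smul]
  · rw [Function.extend_apply' _ _ _ hj]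
    have : j ≠ τ i := fun h => hj ⟨i, h.symm⟩
    simp [basisVec, this, -Complex.coe_smul]

/-- The unilateral weighted shift `e_n ↦ ω_n e_(n+1)` on `ℓ²(ℕ)`. -/
def shift (ω : ℕ → ℝ) : Ell2 ℕ →L[ℂ] Ell2 ℕ := weightedTranslation (fun n => n + 1) ω

/-- The 2-variable weighted shift `T₁ e_k = α_k e_(k+ε₁)`, `T₂ e_k = β_k e_(k+ε₂)` on
`ℓ²(ℕ × ℕ)`. -/
def shift₂ (α β : ℕ × ℕ → ℝ) : Fin 2 → (Ell2 (ℕ × ℕ) →L[ℂ] Ell2 (ℕ × ℕ)) :=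
  ![weightedTranslation (fun k => k + (1, 0)) α, weightedTranslation (fun k => k + (0, 1)) β]

/-- The measure `ξ` is the Berger measure of the weighted shift with weight sequence `ω`: a
probability measure on `[0, ‖W_ω‖²]` whose moments are `ω₀² ⋯ ω_(k-1)²`. -/
structure IsBergerMeasure (ω : ℕ → ℝ) (ξ : Measure ℝ) : Prop where
  isProbabilityMeasure : IsProbabilityMeasure ξ
  support : ξ (Set.Icc 0 (‖shift ω‖ ^ 2))ᶜ = 0
  moments : ∀ k : ℕ, ∏ i ∈ Finset.range k, ω i ^ 2 = ∫ s, s ^ k ∂ξ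

/-- The backward extension `(x, ω₀, ω₁, …)` of a weight sequence. -/
def backwardExt (x : ℝ) (ω : ℕ → ℝ) : ℕ → ℝ
  | 0 => x
  | n + 1 => ω n

/-- Weights of `T₁`: the zeroth row is `(x₀, ω₀, ω₁, …)`, every other row is `(a, ω₀, ω₁, …)`. -/
def rowWeights (x₀ a : ℝ) (ω : ℕ → ℝ) (k : ℕ × ℕ) : ℝ :=
  if k.2 = 0 then backwardExt x₀ ω k.1 else backwardExt a ω k.1

/-- The 2-variable weighted shift with symmetric weight diagram (`β_(i,j) = α_(j,i)`) whose
zeroth row is `(x₀, ω₀, ω₁, …)` and whose other rows are `(a, ω₀, ω₁, …)`. -/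
def symmetricShift (x₀ a : ℝ) (ω : ℕ → ℝ) : Fin 2 → (Ell2 (ℕ × ℕ) →L[ℂ] Ell2 (ℕ × ℕ)) :=
  shift₂ (rowWeights x₀ a ω) (fun k => rowWeights x₀ a ω k.swap)

end

end AluthgeShift

open AluthgeShift

/-!
The shift `W` with symmetric weights is subnormal because it has a Berger measure. Put `η = dξ / s`,
of mass `ρ`. Comparing moments gives
`μ = x₀²a² η × η + x₀²(1 - a²ρ) (η × δ₀ + δ₀ × η) + (1 - 2x₀²ρ + x₀²a²ρ²) δ₀ × δ₀`,
and `μ ≥ 0` as soon as `2x₀²ρ ≤ 1` and `a²ρ ≤ 1`. The first inequality is assumed; the second follows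
from `a < 2x₀ - ω₁` and `1/ρ ≤ ω₀² ≤ ω₁²`, which is logarithmic convexity of the moments of `η`.
A measure with the right moments gives a normal extension directly (`isSubnormalTuple_shift₂`):
multiplication by the coordinates `√s_i e^(2π i t_i)` on `L²` of the product of `μ` with Haar measure
on the torus, where the normalised monomials play the role of the basis vectors `e_k`. The shifts
`[x₀, ξ]` and `[a, ξ]` are the restrictions of the first coordinate of `W` to its rows `0` and `1`, so
they inherit the normal extension.

The Aluthge transform of a weighted translation replaces each weight by the geometric mean of it and
the next one (`aluthge_weightedTranslation`), since the modulus is diagonal and the polar factor is the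
unweighted translation. For the toral transform of `W`, the quadratic form of the self-commutator
matrix at `(e_(1,0), e_(0,1))` equals `2ω₀(ω₁ + a - 2x₀)`, which is negative exactly when
`a < 2x₀ - ω₁`. In one variable, hyponormality means that the weights are nondecreasing, and
geometric means preserve this.

The concrete example is `ω = 1`, `ξ = δ₁`; its joint hyponormality comes from the general fact that
subnormal tuples are jointly hyponormal, proved with Fuglede's theorem.
-/

namespace AluthgeShift

noncomputable section

/-! ### Operators on a Hilbert space -/

section Operators

variable {H : Type*} [NormedAddCommGroup H] [InnerProductSpace ℂ H] [CompleteSpace H]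

theorem inner_star_apply (A : H →L[ℂ] H) (x y : H) : inner ℂ x (star A y) = inner ℂ (A x) y := by
  rw [ContinuousLinearMap.star_eq_adjoint, ContinuousLinearMap.adjoint_inner_right]

theorem modulus_eq {T B : H →L[ℂ] H} (hB : 0 ≤ B) (h : B * B = star T * T) : modulus T = B :=
  CFC.sqrt_unique h hB

theorem aluthge_eq {T V B : H →L[ℂ] H} (hB : 0 ≤ B) (hV : IsPolarFactor T V)
    (h : B * B = modulus T) : aluthge T = B * V * B := by
  rw [aluthge, (existsUnique_polarFactor T).unique (isPolarFactor_polarFactor T) hV,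
    CFC.sqrt_unique h hB]

theorem norm_star_apply_le_of_isHyponormal {T : H →L[ℂ] H} (h : IsHyponormal T) (x : H) :
    ‖star T x‖ ≤ ‖T x‖ := by
  have h1 := ((ContinuousLinearMap.le_def _ _).1 h).inner_nonneg_right x
  have e1 : inner ℂ x (star T (T x)) = ((‖T x‖ ^ 2 : ℝ) : ℂ) := by
    rw [inner_star_apply, inner_self_eq_norm_sq_to_K]
    norm_cast
  have e2 : inner ℂ x (T (star T x)) = ((‖star T x‖ ^ 2 : ℝ) : ℂ) := by
    have := inner_star_apply (star T) x (star T x)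
    rw [star_star] at this
    rw [this, inner_self_eq_norm_sq_to_K]
    norm_cast
  rw [sub_apply, inner_sub_right, mul_apply_eq_comp, mul_apply_eq_comp, e1, e2, sub_nonneg,
    Complex.real_le_real] at h1
  exact (sq_le_sq₀ (norm_nonneg _) (norm_nonneg _)).1 h1

end Operators

/-! ### Weighted translations -/

section BoundedWeights

variable {ι : Type} {v w : ι → ℝ}

theorem bounded_of_bddAbove (h0 : ∀ i, 0 < w i) (hb : BddAbove (Set.range w)) :
    ∃ C, ∀ i, |w i| ≤ C := by
  obtain ⟨C, hC⟩ := hb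
  exact ⟨C, fun i => by rw [abs_of_pos (h0 i)]; exact hC ⟨i, rfl⟩⟩

theorem bounded_one : ∃ C, ∀ i : ι, |(fun _ => 1 : ι → ℝ) i| ≤ C := ⟨1, fun _ => by simp⟩

theorem bounded_mul_comp (hw : ∃ C, ∀ i, |w i| ≤ C) (hv : ∃ C, ∀ i, |v i| ≤ C) (τ : ι → ι) :
    ∃ C, ∀ i, |w i * v (τ i)| ≤ C := by
  obtain ⟨C, hC⟩ := hw
  obtain ⟨D, hD⟩ := hv
  refine ⟨C * D, fun i => ?_⟩
  rw [abs_mul]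
  exact mul_le_mul (hC i) (hD _) (abs_nonneg _) ((abs_nonneg _).trans (hC i))

theorem bounded_sqrt (hw : ∃ C, ∀ i, |w i| ≤ C) : ∃ C, ∀ i, |√(w i)| ≤ C := by
  obtain ⟨C, hC⟩ := hw
  refine ⟨√C, fun i => ?_⟩
  rw [abs_of_nonneg (Real.sqrt_nonneg _)]
  exact Real.sqrt_le_sqrt ((le_abs_self _).trans (hC i))

theorem ker_weightedTranslation {τ : ι → ι} (hτ : τ.Injective) (hw : ∃ C, ∀ i, |w i| ≤ C)
    (h0 : ∀ i, 0 < w i) :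
    LinearMap.ker (weightedTranslation τ w : Ell2 ι →ₗ[ℂ] Ell2 ι) = ⊥ := by
  refine (Submodule.eq_bot_iff _).2 fun f hf => ?_
  ext i
  have h : weightedTranslation τ w f (τ i) = 0 := by
    have : weightedTranslation τ w f = 0 := hf
    rw [this]
    rfl
  rw [weightedTranslation_apply hτ hw, hτ.extend_apply] at h
  exact (mul_eq_zero.1 h).resolve_left (by simpa using (h0 i).ne')

end BoundedWeights

section WeightedTranslation

variable {ι : Type} [DecidableEq ι]

theorem inner_basisVec_left (i : ι) (f : Ell2 ι) : inner ℂ (basisVec i) f = f i := by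
  simp [basisVec, lp.inner_single_left]

theorem basisVec_apply (i j : ι) : basisVec i j = if j = i then (1 : ℂ) else 0 := by
  by_cases h : j = i
  · subst h; simp [basisVec]
  · simp [basisVec, h]

theorem inner_basisVec_basisVec (i j : ι) :
    inner ℂ (basisVec i) (basisVec j) = if i = j then (1 : ℂ) else 0 := by
  rw [inner_basisVec_left, basisVec_apply]

theorem norm_basisVec (i : ι) : ‖basisVec i‖ = 1 := by
  rw [basisVec, lp.norm_single (by norm_num), norm_one]

theorem ext_basisVec {F : Type*} [NormedAddCommGroup F] [NormedSpace ℂ F]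
    {A B : Ell2 ι →L[ℂ] F} (h : ∀ i, A (basisVec i) = B (basisVec i)) : A = B := by
  refine lp.ext_continuousLinearMap (by norm_num) fun i => ?_
  ext
  simpa [basisVec] using h i

variable {σ τ : ι → ι} {v w : ι → ℝ}

theorem weightedTranslation_mul (hσ : σ.Injective) (hτ : τ.Injective) (hv : ∃ C, ∀ i, |v i| ≤ C)
    (hw : ∃ C, ∀ i, |w i| ≤ C) :
    weightedTranslation σ v * weightedTranslation τ w =
      weightedTranslation (σ ∘ τ) (fun i => w i * v (τ i)) := by
  refine ext_basisVec fun i => ?_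
  rw [mul_apply_eq_comp, weightedTranslation_basisVec hτ hw, map_smul,
    weightedTranslation_basisVec hσ hv, weightedTranslation_basisVec (hσ.comp hτ)
      (bounded_mul_comp hw hv τ), smul_smul, Complex.ofReal_mul]
  rfl

theorem star_weightedTranslation_basisVec (hτ : τ.Injective) (hw : ∃ C, ∀ i, |w i| ≤ C) (i : ι) :
    star (weightedTranslation τ w) (basisVec (τ i)) = (w i : ℂ) • basisVec i := by
  ext j
  rw [← inner_basisVec_left, inner_star_apply, weightedTranslation_basisVec hτ hw,
    inner_smul_left, inner_basisVec_basisVec, lp.coeFn_smul, Pi.smul_apply, basisVec_apply,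
    Complex.conj_ofReal, smul_eq_mul]
  by_cases h : j = i
  · simp [h]
  · simp [h, hτ.eq_iff]

theorem star_weightedTranslation_basisVec_of_notMem (hτ : τ.Injective)
    (hw : ∃ C, ∀ i, |w i| ≤ C) {j : ι} (hj : j ∉ Set.range τ) :
    star (weightedTranslation τ w) (basisVec j) = 0 := by
  ext i
  rw [← inner_basisVec_left, inner_star_apply, weightedTranslation_basisVec hτ hw,
    inner_smul_left, inner_basisVec_basisVec, if_neg fun h => hj ⟨i, h⟩, mul_zero]
  rfl

theorem star_weightedTranslation_mul_self (hτ : τ.Injective) (hw : ∃ C, ∀ i, |w i| ≤ C) :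
    star (weightedTranslation τ w) * weightedTranslation τ w =
      weightedTranslation id (fun i => w i * w i) := by
  refine ext_basisVec fun i => ?_
  rw [mul_apply_eq_comp, weightedTranslation_basisVec hτ hw, map_smul,
    star_weightedTranslation_basisVec hτ hw,
    weightedTranslation_basisVec Function.injective_id (w := fun i => w i * w i)
      (bounded_mul_comp hw hw id), smul_smul,
    Complex.ofReal_mul]
  rfl

theorem diagonal_nonneg (hw : ∃ C, ∀ i, |w i| ≤ C) (h0 : ∀ i, 0 ≤ w i) :
    0 ≤ weightedTranslation id w := by
  have h := star_weightedTranslation_mul_self Function.injective_id (bounded_sqrt hw)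
  simp only [Real.mul_self_sqrt (h0 _)] at h
  rw [← h]
  exact star_mul_self_nonneg _

theorem sqrt_mul_sqrt_diagonal (hw : ∃ C, ∀ i, |w i| ≤ C) (h0 : ∀ i, 0 ≤ w i) :
    weightedTranslation id (fun i => √(w i)) * weightedTranslation id (fun i => √(w i)) =
      weightedTranslation id w := by
  rw [weightedTranslation_mul Function.injective_id Function.injective_id (bounded_sqrt hw)
    (bounded_sqrt hw)]
  simp [Real.mul_self_sqrt (h0 _)]

theorem modulus_weightedTranslation (hτ : τ.Injective) (hw : ∃ C, ∀ i, |w i| ≤ C)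
    (h0 : ∀ i, 0 ≤ w i) :
    modulus (weightedTranslation τ w) = weightedTranslation id w := by
  refine modulus_eq (diagonal_nonneg hw h0) ?_
  rw [star_weightedTranslation_mul_self hτ hw,
    weightedTranslation_mul Function.injective_id Function.injective_id hw hw]
  rfl

theorem isPolarFactor_weightedTranslation (hτ : τ.Injective) (hw : ∃ C, ∀ i, |w i| ≤ C)
    (h0 : ∀ i, 0 < w i) :
    IsPolarFactor (weightedTranslation τ w) (weightedTranslation τ (fun _ => 1)) := by
  refine ⟨fun x _ => ?_, ?_, ?_⟩
  · have h := star_weightedTranslation_mul_self hτ (w := fun _ => 1) bounded_one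
    have h1 : weightedTranslation id (fun _ : ι => 1 * 1) = 1 := ext_basisVec fun i => by
      rw [weightedTranslation_basisVec Function.injective_id (bounded_mul_comp bounded_one
        bounded_one id)]
      simp
    rw [h1] at h
    have h2 := (ContinuousLinearMap.norm_map_iff_adjoint_comp_self
      (weightedTranslation τ (fun _ => 1))).2 h
    exact h2 x
  · rw [ker_weightedTranslation hτ hw h0, ker_weightedTranslation hτ bounded_one fun _ => one_pos]
  · rw [modulus_weightedTranslation hτ hw fun i => (h0 i).le,
      weightedTranslation_mul hτ Function.injective_id bounded_one hw]
    simp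

/-- The polar factor of a weighted translation is the unweighted one and its modulus is diagonal;
hence the Aluthge transform replaces each weight by its geometric mean with the next one. -/
theorem aluthge_weightedTranslation (hτ : τ.Injective) (hw : ∃ C, ∀ i, |w i| ≤ C)
    (h0 : ∀ i, 0 < w i) :
    aluthge (weightedTranslation τ w) = weightedTranslation τ (fun i => √(w i * w (τ i))) := by
  have hs := bounded_sqrt hw
  rw [aluthge_eq (diagonal_nonneg hs fun i => Real.sqrt_nonneg _)
    (isPolarFactor_weightedTranslation hτ hw h0)
    ((sqrt_mul_sqrt_diagonal hw fun i => (h0 i).le).trans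
      (modulus_weightedTranslation hτ hw fun i => (h0 i).le).symm),
    weightedTranslation_mul Function.injective_id hτ hs bounded_one,
    weightedTranslation_mul (Function.injective_id.comp hτ) Function.injective_id
      (bounded_mul_comp bounded_one hs τ) hs]
  simp [Real.sqrt_mul (h0 _).le]

theorem commute_weightedTranslation (hσ : σ.Injective) (hτ : τ.Injective)
    (hv : ∃ C, ∀ i, |v i| ≤ C) (hw : ∃ C, ∀ i, |w i| ≤ C) (hστ : σ ∘ τ = τ ∘ σ)
    (h : ∀ i, w i * v (τ i) = v i * w (σ i)) :
    Commute (weightedTranslation σ v) (weightedTranslation τ w) := by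
  rw [Commute, SemiconjBy, weightedTranslation_mul hσ hτ hv hw, weightedTranslation_mul hτ hσ hw hv,
    hστ, funext h]

end WeightedTranslation

/-! ### Hyponormality of one-variable weighted shifts -/

/-- The self-commutator of a weighted shift is diagonal, with entries `ω_n² - ω_(n-1)²` (and `ω₀²`
for `n = 0`). -/
theorem isHyponormal_shift_iff {ω : ℕ → ℝ} (h0 : ∀ n, 0 < ω n) (hb : ∃ C, ∀ n, |ω n| ≤ C) :
    IsHyponormal (shift ω) ↔ ∀ n, ω n ≤ ω (n + 1) := by
  have hinj : Function.Injective (fun n : ℕ => n + 1) := add_left_injective 1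
  constructor
  · intro h n
    have := norm_star_apply_le_of_isHyponormal h (basisVec (n + 1))
    rw [shift, star_weightedTranslation_basisVec hinj hb n, weightedTranslation_basisVec hinj hb,
      norm_smul, norm_smul, norm_basisVec, norm_basisVec, mul_one, mul_one, Complex.norm_real,
      Complex.norm_real, Real.norm_of_nonneg (h0 _).le, Real.norm_of_nonneg (h0 _).le] at this
    exact this
  · intro h
    set d : ℕ → ℝ := fun n => ω n * ω n - (if n = 0 then 0 else ω (n - 1) * ω (n - 1)) with hd
    have hd0 (n : ℕ) : 0 ≤ d n := by
      rcases n with _ | n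
      · simpa [hd] using mul_self_nonneg _
      · simpa [hd] using mul_self_le_mul_self (h0 n).le (h n)
    have hdb : ∃ C, ∀ n, |d n| ≤ C := by
      obtain ⟨C, hC⟩ := bounded_mul_comp hb hb id
      refine ⟨C, fun n => ?_⟩
      rw [abs_of_nonneg (hd0 n)]
      refine le_trans ?_ ((le_abs_self _).trans (hC n))
      simp only [hd, id, sub_le_self_iff]
      split_ifs
      exacts [le_rfl, mul_self_nonneg _]
    have key : star (shift ω) * shift ω - shift ω * star (shift ω) = weightedTranslation id d := by
      rw [shift, star_weightedTranslation_mul_self hinj hb]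
      refine ext_basisVec fun n => ?_
      rw [sub_apply, mul_apply_eq_comp, weightedTranslation_basisVec Function.injective_id hdb,
        weightedTranslation_basisVec Function.injective_id (w := fun i => ω i * ω i)
          (bounded_mul_comp hb hb id)]
      rcases n with _ | n
      · rw [star_weightedTranslation_basisVec_of_notMem hinj hb (by simp)]
        simp [hd]
      · rw [star_weightedTranslation_basisVec hinj hb n, map_smul,
          weightedTranslation_basisVec hinj hb, smul_smul]
        simp [hd, sub_smul, -Complex.coe_smul]
    rw [IsHyponormal, ← sub_nonneg, key]
    exact diagonal_nonneg hdb hd0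

theorem isHyponormal_aluthge_shift {ω : ℕ → ℝ} (h0 : ∀ n, 0 < ω n) (hb : ∃ C, ∀ n, |ω n| ≤ C)
    (h : IsHyponormal (shift ω)) : IsHyponormal (aluthge (shift ω)) := by
  have hm := (isHyponormal_shift_iff h0 hb).1 h
  have e : aluthge (shift ω) = shift (fun n => √(ω n * ω (n + 1))) :=
    aluthge_weightedTranslation (add_left_injective 1) hb h0
  rw [e, isHyponormal_shift_iff (fun n => Real.sqrt_pos.2 (mul_pos (h0 _) (h0 _)))
    (bounded_sqrt (bounded_mul_comp hb hb _))]
  exact fun n => Real.sqrt_le_sqrt (mul_le_mul (hm _) (hm _) (h0 _).le (h0 _).le)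

/-! ### Multiplication operators -/

section Multiplication

open scoped ENNReal

variable {X : Type*} [MeasurableSpace X] {ν : Measure X}

/-- Multiplication by the essentially bounded function `φ` on `L²(ν)`. -/
def mulOp (φ : Lp ℂ ∞ ν) : Lp ℂ 2 ν →L[ℂ] Lp ℂ 2 ν :=
  (ContinuousLinearMap.mul ℂ ℂ).holderL ν ∞ 2 2 φ

theorem coeFn_mulOp (φ : Lp ℂ ∞ ν) (f : Lp ℂ 2 ν) : mulOp φ f =ᵐ[ν] fun x => φ x * f x :=
  (ContinuousLinearMap.mul ℂ ℂ).coeFn_holder φ f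

theorem commute_mulOp (φ ψ : Lp ℂ ∞ ν) : Commute (mulOp φ) (mulOp ψ) := by
  ext f
  rw [mul_apply_eq_comp, mul_apply_eq_comp]
  filter_upwards [coeFn_mulOp φ (mulOp ψ f), coeFn_mulOp ψ (mulOp φ f), coeFn_mulOp φ f,
    coeFn_mulOp ψ f] with x h1 h2 h3 h4
  rw [h1, h2, h3, h4, mul_left_comm]

theorem star_mulOp (φ : Lp ℂ ∞ ν) : star (mulOp φ) = mulOp (star φ) := by
  rw [ContinuousLinearMap.star_eq_adjoint, eq_comm, ContinuousLinearMap.eq_adjoint_iff]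
  intro f g
  rw [L2.inner_def, L2.inner_def]
  refine integral_congr_ae ?_
  filter_upwards [coeFn_mulOp (star φ) f, coeFn_mulOp φ g, Lp.coeFn_star φ] with x h1 h2 h3
  rw [h1, h2, h3, RCLike.inner_apply, RCLike.inner_apply, Pi.star_apply, map_mul,
    ← starRingEnd_apply, starRingEnd_self_apply]
  ring

theorem isNormalTuple_mulOp {n : ℕ} (φ : Fin n → Lp ℂ ∞ ν) : IsNormalTuple fun i => mulOp (φ i) :=
  ⟨fun _ _ => commute_mulOp _ _, fun i => ⟨by rw [star_mulOp]; exact commute_mulOp _ _⟩⟩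

end Multiplication

/-! ### Subnormal tuples -/

open scoped ENNReal in
/-- A tuple of weighted translations is subnormal as soon as it is realised by multiplication
operators on an orthonormal family of `L²(ν)`. -/
theorem isSubnormalTuple_of_mulOp {n : ℕ} {ι X : Type} [DecidableEq ι] [MeasurableSpace X]
    {ν : Measure X} {T : Fin n → (Ell2 ι →L[ℂ] Ell2 ι)} {τ : Fin n → ι → ι} {w : Fin n → ι → ℝ}
    (hT : ∀ i k, T i (basisVec k) = (w i k : ℂ) • basisVec (τ i k)) (φ : Fin n → Lp ℂ ∞ ν)
    {g : ι → Lp ℂ 2 ν} (hg : Orthonormal ℂ g)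
    (h : ∀ i k, mulOp (φ i) (g k) = (w i k : ℂ) • g (τ i k)) : IsSubnormalTuple T := by
  let J : Ell2 ι →ₗᵢ[ℂ] Lp ℂ 2 ν := hg.orthogonalFamily.linearIsometry
  have hJ (k : ι) : J (basisVec k) = g k := by
    simp [J, basisVec]
  refine ⟨Lp ℂ 2 ν, inferInstance, inferInstance, inferInstance, fun i => mulOp (φ i), J,
    isNormalTuple_mulOp φ, fun i x => ?_⟩
  have : mulOp (φ i) ∘L J.toContinuousLinearMap = J.toContinuousLinearMap ∘L T i := by
    refine ext_basisVec fun k => ?_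
    change mulOp (φ i) (J (basisVec k)) = J (T i (basisVec k))
    rw [hT, map_smul, hJ, hJ, h]
  exact congr($this x)

/-- A subnormal tuple remains subnormal after restricting one coordinate to an invariant
subspace. -/
theorem IsSubnormalTuple.isSubnormal {n : ℕ} {H H' : Type} [NormedAddCommGroup H]
    [InnerProductSpace ℂ H] [CompleteSpace H] [NormedAddCommGroup H'] [InnerProductSpace ℂ H']
    [CompleteSpace H'] {T : Fin n → (H →L[ℂ] H)} (hT : IsSubnormalTuple T) (i : Fin n)
    {S : H' →L[ℂ] H'} (ι : H' →ₗᵢ[ℂ] H) (h : ∀ x, T i (ι x) = ι (S x)) : IsSubnormal S := by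
  obtain ⟨K, _, _, _, N, J, hN, hJ⟩ := hT
  refine ⟨K, inferInstance, inferInstance, inferInstance, ![N i], J.comp ι, ⟨fun a b => ?_,
    fun a => ?_⟩, fun a x => ?_⟩
  · rw [Subsingleton.elim a 0, Subsingleton.elim b 0]
  · rw [Subsingleton.elim a 0]
    exact hN.2 i
  · rw [Subsingleton.elim a 0]
    change N i (J (ι x)) = J (ι (S x))
    rw [hJ, h]

/-- If `N` is a normal extension of `T` and `J` the embedding, then
`∑ ⟨x_i, [T_j*, T_i] x_j⟩ = ‖∑ N_i* J x_i‖² - ‖J* ∑ N_i* J x_i‖²`, because `N_j* N_i = N_i N_j*` by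
Fuglede's theorem and `T_i* = J* N_i* J`. -/
theorem IsSubnormalTuple.isJointlyHyponormal {n : ℕ} {H : Type*} [NormedAddCommGroup H]
    [InnerProductSpace ℂ H] [CompleteSpace H] {T : Fin n → (H →L[ℂ] H)}
    (hT : IsSubnormalTuple T) : IsJointlyHyponormal T := by
  obtain ⟨K, _, _, _, N, J, ⟨hc, hn⟩, hJ⟩ := hT
  intro x
  set P : K →L[ℂ] H := ContinuousLinearMap.adjoint J.toContinuousLinearMap with hP
  have hPJ (y : K) (z : H) : inner ℂ (P y) z = inner ℂ y (J z) := by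
    rw [hP, ContinuousLinearMap.adjoint_inner_left]
    rfl
  have hstar (i) (z : H) : star (T i) z = P (star (N i) (J z)) := by
    refine ext_inner_right ℂ fun y => ?_
    rw [hPJ, ContinuousLinearMap.star_eq_adjoint, ContinuousLinearMap.star_eq_adjoint,
      ContinuousLinearMap.adjoint_inner_left, ContinuousLinearMap.adjoint_inner_left, hJ,
      LinearIsometry.inner_map_map]
  have hterm (i j) : inner ℂ (x i) ((star (T j) * T i - T i * star (T j)) (x j)) =
      inner ℂ (star (N i) (J (x i))) (star (N j) (J (x j))) -
        inner ℂ (P (star (N i) (J (x i)))) (P (star (N j) (J (x j)))) := by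
    rw [sub_apply, inner_sub_right, mul_apply_eq_comp, mul_apply_eq_comp, ← hstar, ← hstar]
    congr 1
    · have h1 : Commute (N i) (star (N j)) := (hn j).commute_star_right (hc i j)
      rw [inner_star_apply, ← LinearIsometry.inner_map_map J, ← hJ, ← hJ, ← inner_star_apply,
        ← mul_apply_eq_comp, ← h1.eq, mul_apply_eq_comp]
      nth_rw 1 [← star_star (N i)]
      rw [inner_star_apply]
    · nth_rw 1 [← star_star (T i)]
      rw [inner_star_apply]
  set y := ∑ i, star (N i) (J (x i)) with hy
  have hsum : ∑ i, ∑ j, inner ℂ (x i) ((star (T j) * T i - T i * star (T j)) (x j)) =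
      inner ℂ y y - inner ℂ (P y) (P y) := by
    simp only [hterm, Finset.sum_sub_distrib, hy, map_sum, sum_inner, inner_sum]
    congr 1 <;> exact Finset.sum_comm
  have hle : ‖P y‖ ≤ ‖y‖ := by
    refine (P.le_opNorm y).trans (mul_le_of_le_one_left (norm_nonneg _) ?_)
    rw [hP, LinearIsometryEquiv.norm_map]
    exact J.norm_toContinuousLinearMap_le
  rw [hsum, inner_self_eq_norm_sq_to_K, inner_self_eq_norm_sq_to_K, sub_nonneg]
  norm_cast
  gcongr

/-! ### Two-variable weighted shifts with a moment measure -/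

section MomentMeasure

open scoped ENNReal

theorem integral_conj_fourier_mul (k l : ℕ) :
    ∫ t : UnitAddCircle, starRingEnd ℂ (fourier 1 t ^ k) * fourier 1 t ^ l
      ∂AddCircle.haarAddCircle = if k = l then 1 else 0 := by
  have hpow (m : ℕ) (t : UnitAddCircle) : (fourier 1 t : ℂ) ^ m = fourier (m : ℤ) t := by
    induction m with
    | zero => simp
    | succ m ih => rw [pow_succ, ih, ← fourier_add]; rfl
  have h := (orthonormal_iff_ite.1 (orthonormal_fourier (T := 1))) (k : ℤ) (l : ℤ)
  rw [ContinuousMap.inner_toLp (AddCircle.haarAddCircle (T := 1)) (fourier _) (fourier _)] at h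
  simp only [Nat.cast_inj] at h
  rw [← h]
  refine integral_congr_ae (.of_forall fun t => ?_)
  simp only [hpow]
  ring

/-- The monomial `z₁^k₁ z₂^k₂` in the polar coordinates `z_i = √s_i e^(2π i t_i)`. -/
def polarMonomial (k : ℕ × ℕ) (x : (ℝ × ℝ) × (UnitAddCircle × UnitAddCircle)) : ℂ :=
  ((√x.1.1 ^ k.1 * √x.1.2 ^ k.2 : ℝ) : ℂ) * (fourier 1 x.2.1 ^ k.1 * fourier 1 x.2.2 ^ k.2)

theorem polarMonomial_add (k l : ℕ × ℕ) (x : (ℝ × ℝ) × (UnitAddCircle × UnitAddCircle)) :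
    polarMonomial (k + l) x = polarMonomial l x * polarMonomial k x := by
  simp only [polarMonomial, Prod.fst_add, Prod.snd_add]
  push_cast
  ring

theorem continuous_polarMonomial (k : ℕ × ℕ) : Continuous (polarMonomial k) := by
  unfold polarMonomial
  fun_prop

/-- The product of `μ` with normalised Haar measure on the torus: the image of this measure in
polar coordinates is the rotation invariant measure on `ℂ²` with radial part `μ`. -/
def torusProd (μ : Measure (ℝ × ℝ)) : Measure ((ℝ × ℝ) × (UnitAddCircle × UnitAddCircle)) :=
  μ.prod (AddCircle.haarAddCircle.prod AddCircle.haarAddCircle)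

variable {μ : Measure (ℝ × ℝ)} [IsFiniteMeasure μ] {C : ℝ}

instance : IsFiniteMeasure (torusProd μ) := by
  unfold torusProd
  infer_instance

theorem memLp_polarMonomial (hC : ∀ᵐ s ∂μ, s.1 ∈ Set.Icc 0 C ∧ s.2 ∈ Set.Icc 0 C) (k : ℕ × ℕ)
    (p : ℝ≥0∞) : MemLp (polarMonomial k) p (torusProd μ) := by
  refine MemLp.of_bound (continuous_polarMonomial k).aestronglyMeasurable (√C ^ k.1 * √C ^ k.2) ?_
  have h : ∀ᵐ x ∂torusProd μ, x.1.1 ∈ Set.Icc 0 C ∧ x.1.2 ∈ Set.Icc 0 C :=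
    Measure.quasiMeasurePreserving_fst.ae hC
  filter_upwards [h] with x hx
  have hf (t : UnitAddCircle) : ‖(fourier 1 t : ℂ)‖ = 1 := by
    rw [fourier_one]
    exact Circle.norm_coe _
  rw [polarMonomial, norm_mul, norm_mul, norm_pow, norm_pow, hf, hf, one_pow, one_pow, mul_one,
    mul_one, Complex.norm_real, Real.norm_of_nonneg (by positivity)]
  gcongr
  exacts [hx.1.2, hx.2.2]

theorem integral_conj_polarMonomial_mul (hC : ∀ᵐ s ∂μ, s.1 ∈ Set.Icc 0 C ∧ s.2 ∈ Set.Icc 0 C)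
    (k l : ℕ × ℕ) :
    ∫ x, starRingEnd ℂ (polarMonomial k x) * polarMonomial l x ∂torusProd μ =
      if k = l then ((∫ s, s.1 ^ k.1 * s.2 ^ k.2 ∂μ : ℝ) : ℂ) else 0 := by
  have e (x : (ℝ × ℝ) × (UnitAddCircle × UnitAddCircle)) :
      starRingEnd ℂ (polarMonomial k x) * polarMonomial l x =
        ((√x.1.1 ^ (k.1 + l.1) * √x.1.2 ^ (k.2 + l.2) : ℝ) : ℂ) *
          ((starRingEnd ℂ (fourier 1 x.2.1 ^ k.1) * fourier 1 x.2.1 ^ l.1) *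
            (starRingEnd ℂ (fourier 1 x.2.2 ^ k.2) * fourier 1 x.2.2 ^ l.2)) := by
    simp only [polarMonomial, map_mul, Complex.conj_ofReal]
    push_cast
    ring
  simp only [e]
  rw [torusProd, integral_prod_mul (fun s : ℝ × ℝ =>
      ((√s.1 ^ (k.1 + l.1) * √s.2 ^ (k.2 + l.2) : ℝ) : ℂ))
    (fun t : UnitAddCircle × UnitAddCircle =>
      (starRingEnd ℂ (fourier 1 t.1 ^ k.1) * fourier 1 t.1 ^ l.1) *
        (starRingEnd ℂ (fourier 1 t.2 ^ k.2) * fourier 1 t.2 ^ l.2)),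
    integral_prod_mul (fun t : UnitAddCircle =>
      starRingEnd ℂ (fourier 1 t ^ k.1) * fourier 1 t ^ l.1)
    (fun t : UnitAddCircle => starRingEnd ℂ (fourier 1 t ^ k.2) * fourier 1 t ^ l.2),
    integral_conj_fourier_mul, integral_conj_fourier_mul, integral_complex_ofReal]
  by_cases h : k = l
  · subst h
    simp only [if_true, mul_one]
    congr 1
    refine integral_congr_ae ?_
    filter_upwards [hC] with s hs
    rw [← two_mul, ← two_mul, pow_mul, pow_mul, Real.sq_sqrt hs.1.1, Real.sq_sqrt hs.2.1]
  · rw [if_neg h]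
    by_cases h1 : k.1 = l.1
    · have h2 : k.2 ≠ l.2 := fun h2 => h (Prod.ext h1 h2)
      simp [h2]
    · simp [h1]

/-- If `γ_k = ∫ s₁^k₁ s₂^k₂ dμ` are the moments of a 2-variable weighted shift, then the shift is
subnormal: the normalised monomials `z^k / √γ_k` are orthonormal for the rotation invariant measure
with radial part `μ`, and the shift acts on them as multiplication by the coordinates. -/
theorem isSubnormalTuple_shift₂ {α β γ : ℕ × ℕ → ℝ} (hα : ∀ k, 0 < α k) (hβ : ∀ k, 0 < β k)
    (hαb : ∃ C, ∀ k, |α k| ≤ C) (hβb : ∃ C, ∀ k, |β k| ≤ C) (hγ : ∀ k, 0 < γ k)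
    (hγα : ∀ k, γ (k + (1, 0)) = α k ^ 2 * γ k) (hγβ : ∀ k, γ (k + (0, 1)) = β k ^ 2 * γ k)
    (hC : ∀ᵐ s ∂μ, s.1 ∈ Set.Icc 0 C ∧ s.2 ∈ Set.Icc 0 C)
    (hm : ∀ k : ℕ × ℕ, ∫ s, s.1 ^ k.1 * s.2 ^ k.2 ∂μ = γ k) :
    IsSubnormalTuple (shift₂ α β) := by
  let ε : Fin 2 → ℕ × ℕ := ![(1, 0), (0, 1)]
  let w : Fin 2 → ℕ × ℕ → ℝ := ![α, β]
  have hw0 (i k) : 0 < w i k := by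
    fin_cases i
    exacts [hα k, hβ k]
  have hγw (i k) : γ (k + ε i) = w i k ^ 2 * γ k := by
    fin_cases i
    exacts [hγα k, hγβ k]
  have hT (i k) : shift₂ α β i (basisVec k) = (w i k : ℂ) • basisVec (k + ε i) := by
    fin_cases i
    exacts [weightedTranslation_basisVec (add_left_injective _) hαb k,
      weightedTranslation_basisVec (add_left_injective _) hβb k]
  let m (k : ℕ × ℕ) : Lp ℂ 2 (torusProd μ) := (memLp_polarMonomial hC k 2).toLp _
  have hmk (k) : m k =ᵐ[torusProd μ] polarMonomial k := MemLp.coeFn_toLp _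
  have hinner (k l) : inner ℂ (m k) (m l) = if k = l then (γ k : ℂ) else 0 := by
    rw [← hm, ← integral_conj_polarMonomial_mul hC, L2.inner_def]
    refine integral_congr_ae ?_
    filter_upwards [hmk k, hmk l] with x h1 h2
    rw [h1, h2, RCLike.inner_apply, mul_comm]
  have hsq (k) : (√(γ k))⁻¹ * ((√(γ k))⁻¹ * γ k) = 1 := by
    have := (Real.sqrt_pos.2 (hγ k)).ne'
    field_simp
    exact (Real.sq_sqrt (hγ k).le).symm
  let g (k : ℕ × ℕ) : Lp ℂ 2 (torusProd μ) := (((√(γ k))⁻¹ : ℝ) : ℂ) • m k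
  have hg : Orthonormal ℂ g := by
    refine orthonormal_iff_ite.2 fun k l => ?_
    rw [inner_smul_left, inner_smul_right, hinner, Complex.conj_ofReal]
    split_ifs with h
    · subst h
      exact_mod_cast hsq k
    · simp
  refine isSubnormalTuple_of_mulOp hT (fun i => (memLp_polarMonomial hC (ε i) ∞).toLp _) hg
    fun i k => ?_
  have hmul : mulOp ((memLp_polarMonomial hC (ε i) ∞).toLp _) (m k) = m (k + ε i) := by
    ext1
    filter_upwards [coeFn_mulOp ((memLp_polarMonomial hC (ε i) ∞).toLp _) (m k),
      MemLp.coeFn_toLp (memLp_polarMonomial hC (ε i) ∞), hmk k, hmk (k + ε i)] with x h1 h2 h3 h4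
    rw [h1, h2, h3, h4, polarMonomial_add]
  rw [map_smul, hmul, smul_smul, ← Complex.ofReal_mul]
  congr 2
  rw [hγw, Real.sqrt_mul (sq_nonneg _), Real.sqrt_sq (hw0 i k).le]
  have := (hw0 i k).ne'
  have := (Real.sqrt_pos.2 (hγ k)).ne'
  field_simp

end MomentMeasure

/-! ### The measure `dξ / s` -/

section CoreMeasure

/-- The moments of `dξ / s` when `ξ` is the Berger measure of `W_ω` and `ρ = ∫ 1/s dξ`: apart from
the total mass `ρ` they are the moments of `ξ`, shifted by one. -/
def coreMoment (ρ : ℝ) (ω : ℕ → ℝ) : ℕ → ℝ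
  | 0 => ρ
  | n + 1 => ∏ i ∈ Finset.range n, ω i ^ 2

theorem coreMoment_add_two (ρ : ℝ) (ω : ℕ → ℝ) (n : ℕ) :
    coreMoment ρ ω (n + 2) = ω n ^ 2 * coreMoment ρ ω (n + 1) := by
  rw [coreMoment, coreMoment, Finset.prod_range_succ, mul_comm]

theorem coreMoment_succ_pos (ρ : ℝ) {ω : ℕ → ℝ} (hω : ∀ n, 0 < ω n) (n : ℕ) :
    0 < coreMoment ρ ω (n + 1) :=
  Finset.prod_pos fun i _ => pow_pos (hω i) 2

/-- The measure `dξ / s`, for `ξ` carried by `(0, ∞)`: the density is `0` where `s ≤ 0`. -/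
def coreMeasure (ξ : Measure ℝ) : Measure ℝ := ξ.withDensity fun s => ENNReal.ofReal (1 / s)

variable {ω : ℕ → ℝ} {ξ : Measure ℝ}

theorem isFiniteMeasure_coreMeasure (hi : Integrable (fun s : ℝ => 1 / s) ξ) :
    IsFiniteMeasure (coreMeasure ξ) :=
  isFiniteMeasure_withDensity_ofReal hi.2

theorem ae_coreMeasure_mem_Icc (hξ : IsBergerMeasure ω ξ) :
    ∀ᵐ s ∂coreMeasure ξ, s ∈ Set.Icc 0 (‖shift ω‖ ^ 2) :=
  (withDensity_absolutelyContinuous _ _).ae_le (mem_ae_iff.2 hξ.support)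

theorem integral_pow_coreMeasure (hξ : IsBergerMeasure ω ξ) (h0 : ξ {0} = 0) (n : ℕ) :
    ∫ s, s ^ n ∂coreMeasure ξ = coreMoment (∫ s, 1 / s ∂ξ) ω n := by
  have hpos : ∀ᵐ s ∂ξ, 0 < s := by
    have h1 : ∀ᵐ s ∂ξ, s ∈ Set.Icc 0 (‖shift ω‖ ^ 2) := mem_ae_iff.2 hξ.support
    have h2 : ∀ᵐ s ∂ξ, s ≠ 0 := by
      rw [ae_iff]
      simpa using h0
    filter_upwards [h1, h2] with s hs hs'
    exact lt_of_le_of_ne hs.1 (Ne.symm hs')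
  rw [coreMeasure, integral_withDensity_eq_integral_toReal_smul (by fun_prop)
    (.of_forall fun _ => ENNReal.ofReal_lt_top)]
  rcases n with _ | n
  · refine integral_congr_ae ?_
    filter_upwards [hpos] with s hs
    rw [ENNReal.toReal_ofReal (by positivity), pow_zero, smul_eq_mul, mul_one]
  · rw [coreMoment, hξ.moments]
    refine integral_congr_ae ?_
    filter_upwards [hpos] with s hs
    rw [ENNReal.toReal_ofReal (by positivity), smul_eq_mul, pow_succ']
    field_simp

theorem integrable_pow_of_ae_mem_Icc {κ : Measure ℝ} [IsFiniteMeasure κ] {C : ℝ}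
    (h : ∀ᵐ s ∂κ, s ∈ Set.Icc 0 C) (n : ℕ) : Integrable (fun s => s ^ n) κ := by
  refine Integrable.of_bound (by fun_prop) (C ^ n) ?_
  filter_upwards [h] with s hs
  rw [Real.norm_of_nonneg (pow_nonneg hs.1 n)]
  exact pow_le_pow_left₀ hs.1 hs.2 n

/-- Moments of a positive measure are logarithmically convex (Cauchy–Schwarz). -/
theorem sq_integral_pow_le {κ : Measure ℝ} [IsFiniteMeasure κ] {C : ℝ}
    (h : ∀ᵐ s ∂κ, s ∈ Set.Icc 0 C) (n : ℕ) (h2 : 0 < ∫ s, s ^ (n + 2) ∂κ) :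
    (∫ s, s ^ (n + 1) ∂κ) ^ 2 ≤ (∫ s, s ^ n ∂κ) * ∫ s, s ^ (n + 2) ∂κ := by
  -- expand `∫ s^n (q - p s)² dκ ≥ 0`, where `p` and `q` are the next two moments
  set p := ∫ s, s ^ (n + 1) ∂κ
  set q := ∫ s, s ^ (n + 2) ∂κ
  have hi := integrable_pow_of_ae_mem_Icc h
  have key : ∫ s, s ^ n * (q - p * s) ^ 2 ∂κ = q ^ 2 * (∫ s, s ^ n ∂κ) - q * p ^ 2 := by
    have e (s : ℝ) : s ^ n * (q - p * s) ^ 2 =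
        q ^ 2 * s ^ n - 2 * q * p * s ^ (n + 1) + p ^ 2 * s ^ (n + 2) := by ring
    simp only [e]
    have i₀ := (hi n).const_mul (q ^ 2)
    have i₁ := (hi (n + 1)).const_mul (2 * q * p)
    have i₂ := (hi (n + 2)).const_mul (p ^ 2)
    rw [integral_add (f := fun s => q ^ 2 * s ^ n - 2 * q * p * s ^ (n + 1)) (i₀.sub i₁) i₂,
      integral_sub i₀ i₁, integral_const_mul,
      integral_const_mul, integral_const_mul]
    change q ^ 2 * _ - 2 * q * p * p + p ^ 2 * q = _
    ring
  have hnn : 0 ≤ ∫ s, s ^ n * (q - p * s) ^ 2 ∂κ := by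
    refine integral_nonneg_of_ae ?_
    filter_upwards [h] with s hs
    exact mul_nonneg (pow_nonneg hs.1 n) (sq_nonneg _)
  rw [key] at hnn
  refine le_of_mul_le_mul_left ?_ h2
  linarith

/-- The first weights of a shift with Berger measure `ξ` satisfy `1/ρ ≤ ω₀² ≤ ω₁²`. -/
theorem one_le_sq_mul_and_weight_le (hω : ∀ n, 0 < ω n) (hξ : IsBergerMeasure ω ξ)
    (h0 : ξ {0} = 0) (hi : Integrable (fun s : ℝ => 1 / s) ξ) :
    1 ≤ ω 0 ^ 2 * ∫ s, 1 / s ∂ξ ∧ ω 0 ^ 2 ≤ ω 1 ^ 2 := by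
  have := isFiniteMeasure_coreMeasure hi
  have hm := integral_pow_coreMeasure hξ h0
  have hconv (n : ℕ) := sq_integral_pow_le (ae_coreMeasure_mem_Icc hξ) n
    (by rw [hm]; exact coreMoment_succ_pos _ hω _)
  have h1 := hconv 0
  have h2 := hconv 1
  simp only [hm] at h1 h2
  have hω0 := pow_pos (hω 0) 2
  simp only [coreMoment, Finset.prod_range_succ, Finset.prod_range_zero] at h1 h2
  exact ⟨by linarith, by nlinarith⟩

end CoreMeasure

/-! ### Moments of the symmetric shift -/

section SymmetricMoments

/-- The moments of the symmetric shift in terms of those of `dξ / s` and of the point mass at `0`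
(whose `n`-th moment is `0 ^ n`). -/
def symmetricMoment (x₀ a ρ : ℝ) (ω : ℕ → ℝ) (k : ℕ × ℕ) : ℝ :=
  x₀ ^ 2 * a ^ 2 * (coreMoment ρ ω k.1 * coreMoment ρ ω k.2) +
    x₀ ^ 2 * (1 - a ^ 2 * ρ) * (coreMoment ρ ω k.1 * 0 ^ k.2) +
    x₀ ^ 2 * (1 - a ^ 2 * ρ) * (0 ^ k.1 * coreMoment ρ ω k.2) +
    (1 - 2 * x₀ ^ 2 * ρ + x₀ ^ 2 * a ^ 2 * ρ ^ 2) * (0 ^ k.1 * 0 ^ k.2)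

variable {x₀ a ρ : ℝ} {ω : ℕ → ℝ}

theorem symmetricMoment_swap (k : ℕ × ℕ) :
    symmetricMoment x₀ a ρ ω k.swap = symmetricMoment x₀ a ρ ω k := by
  simp only [symmetricMoment, Prod.fst_swap, Prod.snd_swap]
  ring

theorem symmetricMoment_add_fst (k : ℕ × ℕ) :
    symmetricMoment x₀ a ρ ω (k + (1, 0)) =
      rowWeights x₀ a ω k ^ 2 * symmetricMoment x₀ a ρ ω k := by
  obtain ⟨_ | n, _ | m⟩ := k
  · simp [symmetricMoment, rowWeights, backwardExt, coreMoment]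
    ring
  · simp [symmetricMoment, rowWeights, backwardExt, coreMoment]
    ring
  · simp [symmetricMoment, rowWeights, backwardExt, coreMoment_add_two]
    ring
  · simp [symmetricMoment, rowWeights, backwardExt, coreMoment_add_two]
    ring

theorem symmetricMoment_add_snd (k : ℕ × ℕ) :
    symmetricMoment x₀ a ρ ω (k + (0, 1)) =
      rowWeights x₀ a ω k.swap ^ 2 * symmetricMoment x₀ a ρ ω k := by
  rw [← symmetricMoment_swap, ← symmetricMoment_swap k, ← symmetricMoment_add_fst]
  rfl

theorem rowWeights_pos (hx₀ : 0 < x₀) (ha : 0 < a) (hω : ∀ n, 0 < ω n) (k : ℕ × ℕ) :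
    0 < rowWeights x₀ a ω k := by
  obtain ⟨_ | n, _ | m⟩ := k <;> simp [rowWeights, backwardExt, *]

theorem symmetricMoment_pos (hx₀ : 0 < x₀) (ha : 0 < a) (hω : ∀ n, 0 < ω n) (k : ℕ × ℕ) :
    0 < symmetricMoment x₀ a ρ ω k := by
  have hα := rowWeights_pos hx₀ ha hω
  obtain ⟨n, m⟩ := k
  induction n with
  | zero =>
    induction m with
    | zero =>
      have : symmetricMoment x₀ a ρ ω (0, 0) = 1 := by
        simp [symmetricMoment, coreMoment]
        ring
      rw [this]
      exact one_pos
    | succ m ih =>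
      have := symmetricMoment_add_snd (x₀ := x₀) (a := a) (ρ := ρ) (ω := ω) (0, m)
      rw [show ((0, m + 1) : ℕ × ℕ) = (0, m) + (0, 1) from rfl, this]
      exact mul_pos (pow_pos (hα _) 2) ih
  | succ n ih =>
    rw [show ((n + 1, m) : ℕ × ℕ) = (n, m) + (1, 0) from rfl, symmetricMoment_add_fst]
    exact mul_pos (pow_pos (hα _) 2) ih

theorem bounded_rowWeights (hb : ∃ C, ∀ n, |ω n| ≤ C) : ∃ C, ∀ k, |rowWeights x₀ a ω k| ≤ C := by
  obtain ⟨C, hC⟩ := hb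
  refine ⟨max (max |x₀| |a|) C, fun k => ?_⟩
  obtain ⟨_ | n, _ | m⟩ := k <;> simp [rowWeights, backwardExt, hC]

end SymmetricMoments

/-! ### Subnormality of the symmetric shift -/

section Subnormality

theorem integral_prod_pow (κ κ' : Measure ℝ) [SFinite κ] [SFinite κ'] (k : ℕ × ℕ) :
    ∫ s, s.1 ^ k.1 * s.2 ^ k.2 ∂κ.prod κ' = (∫ s, s ^ k.1 ∂κ) * ∫ s, s ^ k.2 ∂κ' :=
  integral_prod_mul (fun s : ℝ => s ^ k.1) (fun s : ℝ => s ^ k.2)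

variable {x₀ a : ℝ} {ω : ℕ → ℝ} {ξ : Measure ℝ}

/-- The Berger measure of the symmetric shift is
`x₀²a² η × η + x₀²(1 - a²ρ) (η × δ₀ + δ₀ × η) + (1 - 2x₀²ρ + x₀²a²ρ²) δ₀ × δ₀` with `η = dξ / s`;
the hypotheses make the coefficients nonnegative. -/
theorem isSubnormalTuple_symmetricShift (hω : ∀ n, 0 < ω n) (hb : ∃ C, ∀ n, |ω n| ≤ C)
    (hξ : IsBergerMeasure ω ξ) (h0 : ξ {0} = 0) (hi : Integrable (fun s : ℝ => 1 / s) ξ)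
    (hx₀ : 0 < x₀) (ha : 0 < a) (hx₀ρ : 2 * x₀ ^ 2 * (∫ s, 1 / s ∂ξ) ≤ 1)
    (haρ : a ^ 2 * (∫ s, 1 / s ∂ξ) ≤ 1) : IsSubnormalTuple (symmetricShift x₀ a ω) := by
  set ρ := ∫ s, 1 / s ∂ξ with hρ
  have hfin := isFiniteMeasure_coreMeasure hi
  set η := coreMeasure ξ
  have hη : ∀ᵐ s ∂η, s ∈ Set.Icc 0 (‖shift ω‖ ^ 2) := ae_coreMeasure_mem_Icc hξ
  have hδ : ∀ᵐ s ∂(Measure.dirac 0 : Measure ℝ), s ∈ Set.Icc 0 (‖shift ω‖ ^ 2) := by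
    rw [ae_dirac_eq]
    exact ⟨le_rfl, sq_nonneg _⟩
  have hprod {κ κ' : Measure ℝ} [IsFiniteMeasure κ] [IsFiniteMeasure κ']
      (h : ∀ᵐ s ∂κ, s ∈ Set.Icc 0 (‖shift ω‖ ^ 2)) (h' : ∀ᵐ s ∂κ', s ∈ Set.Icc 0 (‖shift ω‖ ^ 2)) :
      ∀ᵐ s ∂κ.prod κ', s.1 ∈ Set.Icc 0 (‖shift ω‖ ^ 2) ∧ s.2 ∈ Set.Icc 0 (‖shift ω‖ ^ 2) :=
    (Measure.quasiMeasurePreserving_fst.ae h).and (Measure.quasiMeasurePreserving_snd.ae h')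
  have hint {κ κ' : Measure ℝ} [IsFiniteMeasure κ] [IsFiniteMeasure κ']
      (h : ∀ᵐ s ∂κ, s ∈ Set.Icc 0 (‖shift ω‖ ^ 2)) (h' : ∀ᵐ s ∂κ', s ∈ Set.Icc 0 (‖shift ω‖ ^ 2))
      (c : NNReal) (k : ℕ × ℕ) : Integrable (fun s => s.1 ^ k.1 * s.2 ^ k.2) (c • κ.prod κ') :=
    ((integrable_pow_of_ae_mem_Icc h k.1).mul_prod
      (integrable_pow_of_ae_mem_Icc h' k.2)).smul_measure_nnreal
  have hc₁ : 0 ≤ x₀ ^ 2 * a ^ 2 := by positivity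
  have hc₂ : 0 ≤ x₀ ^ 2 * (1 - a ^ 2 * ρ) := mul_nonneg (sq_nonneg _) (sub_nonneg.2 haρ)
  have hc₃ : 0 ≤ 1 - 2 * x₀ ^ 2 * ρ + x₀ ^ 2 * a ^ 2 * ρ ^ 2 :=
    add_nonneg (sub_nonneg.2 hx₀ρ) (by positivity)
  let c₁ : NNReal := ⟨_, hc₁⟩
  let c₂ : NNReal := ⟨_, hc₂⟩
  let c₃ : NNReal := ⟨_, hc₃⟩
  let δ : Measure ℝ := Measure.dirac 0
  refine isSubnormalTuple_shift₂ (γ := symmetricMoment x₀ a ρ ω)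
    (μ := c₁ • η.prod η + c₂ • η.prod δ + c₂ • δ.prod η + c₃ • δ.prod δ) (C := ‖shift ω‖ ^ 2)
    (rowWeights_pos hx₀ ha hω) (fun k => rowWeights_pos hx₀ ha hω k.swap) (bounded_rowWeights hb)
    ?_ (symmetricMoment_pos hx₀ ha hω) symmetricMoment_add_fst symmetricMoment_add_snd ?_ ?_
  · obtain ⟨C, hC⟩ := bounded_rowWeights (x₀ := x₀) (a := a) hb
    exact ⟨C, fun k => hC k.swap⟩
  · simp only [ae_add_measure_iff]
    exact ⟨⟨⟨Measure.ae_smul_measure (hprod hη hη) _, Measure.ae_smul_measure (hprod hη hδ) _⟩,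
      Measure.ae_smul_measure (hprod hδ hη) _⟩, Measure.ae_smul_measure (hprod hδ hδ) _⟩
  · intro k
    rw [integral_add_measure (((hint hη hη _ k).add_measure (hint hη hδ _ k)).add_measure
        (hint hδ hη _ k)) (hint hδ hδ _ k),
      integral_add_measure ((hint hη hη _ k).add_measure (hint hη hδ _ k)) (hint hδ hη _ k),
      integral_add_measure (hint hη hη _ k) (hint hη hδ _ k)]
    simp only [integral_smul_nnreal_measure, integral_prod_pow, η,
      integral_pow_coreMeasure hξ h0, integral_dirac]
    rfl

theorem orthonormal_basisVec_row (j : ℕ) :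
    Orthonormal ℂ fun n : ℕ => (basisVec (n, j) : Ell2 (ℕ × ℕ)) := by
  refine orthonormal_iff_ite.2 fun n m => ?_
  rw [inner_basisVec_basisVec]
  simp

/-- The span of the basis vectors `e_(n,j)` with `j` fixed is invariant under the first coordinate of
a 2-variable weighted shift. -/
theorem isSubnormal_shift_row {α β : ℕ × ℕ → ℝ} (hα : ∃ C, ∀ k, |α k| ≤ C)
    (h : IsSubnormalTuple (shift₂ α β)) (j : ℕ) : IsSubnormal (shift fun n => α (n, j)) := by
  have hr : ∃ C, ∀ n, |α (n, j)| ≤ C := hα.imp fun C hC n => hC _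
  let ι := (orthonormal_basisVec_row j).orthogonalFamily.linearIsometry
  have hι (n : ℕ) : ι (basisVec n) = basisVec (n, j) := by
    simp only [ι, basisVec, OrthogonalFamily.linearIsometry_apply_single]
    simp
  refine h.isSubnormal 0 ι fun x => ?_
  have : shift₂ α β 0 ∘L ι.toContinuousLinearMap =
      ι.toContinuousLinearMap ∘L shift fun n => α (n, j) := by
    refine ext_basisVec fun n => ?_
    change weightedTranslation (fun k => k + (1, 0)) α (ι (basisVec n)) =
      ι (weightedTranslation (fun n => n + 1) (fun n => α (n, j)) (basisVec n))
    rw [weightedTranslation_basisVec (add_left_injective 1) hr, map_smul, hι, hι,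
      weightedTranslation_basisVec (add_left_injective _) hα]
    rfl
  exact congr($this x)

end Subnormality

/-! ### The toral Aluthge transform of the symmetric shift -/

section Toral

/-- Positivity of the self-commutator matrix tested on the vector `(e_(1,0), e_(0,1))`. -/
theorem IsJointlyHyponormal.le_of_shift₂ {α β : ℕ × ℕ → ℝ} (hα : ∃ C, ∀ k, |α k| ≤ C)
    (hβ : ∃ C, ∀ k, |β k| ≤ C) (h : IsJointlyHyponormal (shift₂ α β)) :
    0 ≤ (α (1, 0) ^ 2 - α (0, 0) ^ 2) + 2 * (α (0, 1) * β (1, 0) - α (0, 0) * β (0, 0)) +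
      (β (0, 1) ^ 2 - β (0, 0) ^ 2) := by
  have h1 := h ![basisVec (1, 0), basisVec (0, 1)]
  have hinj (c : ℕ × ℕ) : Function.Injective (fun k : ℕ × ℕ => k + c) := add_left_injective c
  have A (k : ℕ × ℕ) : weightedTranslation (fun k => k + (1, 0)) α (basisVec k) =
      (α k : ℂ) • basisVec (k + (1, 0)) := weightedTranslation_basisVec (hinj _) hα k
  have B (k : ℕ × ℕ) : weightedTranslation (fun k => k + (0, 1)) β (basisVec k) =
      (β k : ℂ) • basisVec (k + (0, 1)) := weightedTranslation_basisVec (hinj _) hβ k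
  have A' (n m : ℕ) : star (weightedTranslation (fun k => k + (1, 0)) α) (basisVec (n + 1, m)) =
      (α (n, m) : ℂ) • basisVec (n, m) := star_weightedTranslation_basisVec (hinj _) hα (n, m)
  have B' (n m : ℕ) : star (weightedTranslation (fun k => k + (0, 1)) β) (basisVec (n, m + 1)) =
      (β (n, m) : ℂ) • basisVec (n, m) := star_weightedTranslation_basisVec (hinj _) hβ (n, m)
  have A1 := A' 0 0
  have A2 := A' 1 0
  have A3 := A' 0 1
  have B1 := B' 0 0
  have B2 := B' 0 1
  have B3 := B' 1 0
  norm_num only at A1 A2 A3 B1 B2 B3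
  simp only [shift₂, Fin.sum_univ_two, Matrix.cons_val_zero, Matrix.cons_val_one, sub_apply,
    mul_apply_eq_comp, A, B, A1, A2, A3, B1, B2, B3, map_smul, inner_sub_right, inner_smul_right,
    inner_basisVec_basisVec, Prod.mk_add_mk, Nat.reduceAdd, if_true, mul_one] at h1
  have h2 : (0 : ℂ) ≤ (((α (1, 0) ^ 2 - α (0, 0) ^ 2) +
      2 * (α (0, 1) * β (1, 0) - α (0, 0) * β (0, 0)) + (β (0, 1) ^ 2 - β (0, 0) ^ 2) : ℝ) : ℂ) := by
    refine h1.trans_eq ?_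
    push_cast
    ring
  exact_mod_cast h2

variable {x₀ a : ℝ} {ω : ℕ → ℝ}

theorem commute_shift₂ {α β : ℕ × ℕ → ℝ} (hα : ∃ C, ∀ k, |α k| ≤ C) (hβ : ∃ C, ∀ k, |β k| ≤ C)
    (h : ∀ k, β k * α (k + (0, 1)) = α k * β (k + (1, 0))) :
    Commute (shift₂ α β 0) (shift₂ α β 1) :=
  commute_weightedTranslation (add_left_injective _) (add_left_injective _) hα hβ
    (funext fun k => add_right_comm k _ _) h

theorem toralAluthge_shift₂ {α β : ℕ × ℕ → ℝ} (hα : ∃ C, ∀ k, |α k| ≤ C)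
    (hβ : ∃ C, ∀ k, |β k| ≤ C) (hα0 : ∀ k, 0 < α k) (hβ0 : ∀ k, 0 < β k) :
    toralAluthge (shift₂ α β) =
      shift₂ (fun k => √(α k * α (k + (1, 0)))) (fun k => √(β k * β (k + (0, 1)))) := by
  funext i
  fin_cases i
  exacts [aluthge_weightedTranslation (add_left_injective _) hα hα0,
    aluthge_weightedTranslation (add_left_injective _) hβ hβ0]

theorem bounded_comp_swap {α : ℕ × ℕ → ℝ} (hα : ∃ C, ∀ k, |α k| ≤ C) :
    ∃ C, ∀ k : ℕ × ℕ, |α k.swap| ≤ C :=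
  hα.imp fun _ hC k => hC k.swap

theorem commute_symmetricShift (hb : ∃ C, ∀ n, |ω n| ≤ C) :
    Commute (symmetricShift x₀ a ω 0) (symmetricShift x₀ a ω 1) := by
  have hα := bounded_rowWeights (x₀ := x₀) (a := a) hb
  refine commute_shift₂ hα (bounded_comp_swap hα) fun k => ?_
  obtain ⟨_ | n, _ | m⟩ := k <;> simp [rowWeights, backwardExt, mul_comm]

theorem toralAluthge_symmetricShift (hb : ∃ C, ∀ n, |ω n| ≤ C) (hω : ∀ n, 0 < ω n) (hx₀ : 0 < x₀)
    (ha : 0 < a) :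
    toralAluthge (symmetricShift x₀ a ω) =
      shift₂ (fun k => √(rowWeights x₀ a ω k * rowWeights x₀ a ω (k + (1, 0))))
        (fun k => √(rowWeights x₀ a ω k.swap * rowWeights x₀ a ω (k + (0, 1)).swap)) :=
  toralAluthge_shift₂ (bounded_rowWeights hb) (bounded_comp_swap (bounded_rowWeights hb))
    (rowWeights_pos hx₀ ha hω) (fun k => rowWeights_pos hx₀ ha hω k.swap)

theorem commute_toralAluthge_symmetricShift (hb : ∃ C, ∀ n, |ω n| ≤ C) (hω : ∀ n, 0 < ω n)
    (hx₀ : 0 < x₀) (ha : 0 < a) :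
    Commute (toralAluthge (symmetricShift x₀ a ω) 0) (toralAluthge (symmetricShift x₀ a ω) 1) := by
  have hα := bounded_rowWeights (x₀ := x₀) (a := a) hb
  have hp := rowWeights_pos hx₀ ha hω
  rw [toralAluthge_symmetricShift hb hω hx₀ ha]
  refine commute_shift₂ (bounded_sqrt (bounded_mul_comp hα hα _))
    (bounded_sqrt (bounded_mul_comp (bounded_comp_swap hα) (bounded_comp_swap hα) _)) fun k => ?_
  rw [← Real.sqrt_mul (mul_pos (hp _) (hp _)).le, ← Real.sqrt_mul (mul_pos (hp _) (hp _)).le]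
  congr 1
  obtain ⟨_ | n, _ | m⟩ := k <;> simp [rowWeights, backwardExt] <;> ring

/-- On the test vector the self-commutator matrix of the toral Aluthge transform takes the value
`2 ω₀ (ω₁ + a - 2 x₀)`. -/
theorem not_isJointlyHyponormal_toralAluthge_symmetricShift (hb : ∃ C, ∀ n, |ω n| ≤ C)
    (hω : ∀ n, 0 < ω n) (hx₀ : 0 < x₀) (ha : 0 < a) (h : a < 2 * x₀ - ω 1) :
    ¬ IsJointlyHyponormal (toralAluthge (symmetricShift x₀ a ω)) := by
  intro hyp
  have hα := bounded_rowWeights (x₀ := x₀) (a := a) hb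
  rw [toralAluthge_symmetricShift hb hω hx₀ ha] at hyp
  have h1 := hyp.le_of_shift₂ (bounded_sqrt (bounded_mul_comp hα hα _))
    (bounded_sqrt (bounded_mul_comp (bounded_comp_swap hα) (bounded_comp_swap hα) _))
  have hω0 := hω 0
  have hω1 := hω 1
  simp only [rowWeights, backwardExt, Prod.mk_add_mk, Nat.reduceAdd, if_true, Prod.swap_prod_mk,
    one_ne_zero, if_false] at h1
  rw [Real.mul_self_sqrt (by positivity), Real.mul_self_sqrt (by positivity),
    Real.sq_sqrt (by positivity), Real.sq_sqrt (by positivity)] at h1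
  nlinarith

end Toral

/-! ### The range of the parameters and an example -/

section Parameters

variable {ω : ℕ → ℝ} {ξ : Measure ℝ} {ρ x₀ a : ℝ}

theorem exists_parameters (hρ : 0 < ρ) (h : ω 1 ^ 2 * ρ < 2) :
    ∃ x₀ a : ℝ, 0 < x₀ ∧ ω 1 ^ 2 / 4 < x₀ ^ 2 ∧ x₀ ^ 2 ≤ 1 / (2 * ρ) ∧
      0 < a ∧ a < 2 * x₀ - ω 1 := by
  have hx : √(1 / (2 * ρ)) ^ 2 = 1 / (2 * ρ) := Real.sq_sqrt (by positivity)
  have h1 : ω 1 ^ 2 / 4 < √(1 / (2 * ρ)) ^ 2 := by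
    rw [hx, div_lt_div_iff₀ (by norm_num) (by positivity)]
    linarith
  have h2 : ω 1 / 2 < √(1 / (2 * ρ)) :=
    lt_of_pow_lt_pow_left₀ 2 (Real.sqrt_nonneg _) (by linarith [div_pow (ω 1) 2 2])
  exact ⟨√(1 / (2 * ρ)), (2 * √(1 / (2 * ρ)) - ω 1) / 2, by positivity, h1, hx.le,
    by linarith, by linarith⟩

/-- As `x₀² ≤ 1/(2ρ) ≤ ω₀²/2 < ω₁²`, the bound `a < 2x₀ - ω₁` forces `a < x₀`, so both
`[x₀, ξ]` and `[a, ξ]` satisfy the criterion for a subnormal backward extension. -/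
theorem parameter_bounds (hω : ∀ n, 0 < ω n) (hρ : 0 < ρ) (h1 : 1 ≤ ω 0 ^ 2 * ρ)
    (h2 : ω 0 ^ 2 ≤ ω 1 ^ 2) (hx : x₀ ^ 2 ≤ 1 / (2 * ρ)) (ha : 0 < a)
    (hax : a < 2 * x₀ - ω 1) : 2 * x₀ ^ 2 * ρ ≤ 1 ∧ a ^ 2 * ρ ≤ 1 := by
  rw [le_div_iff₀ (by positivity)] at hx
  have hxω : x₀ < ω 1 := by
    refine lt_of_pow_lt_pow_left₀ 2 (hω 1).le (lt_of_mul_lt_mul_right ?_ hρ.le)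
    nlinarith
  have hax' : a ^ 2 ≤ x₀ ^ 2 := pow_le_pow_left₀ ha.le (by linarith) 2
  exact ⟨by linarith, by nlinarith⟩

theorem isBergerMeasure_dirac_one : IsBergerMeasure (fun _ => 1) (Measure.dirac 1) where
  isProbabilityMeasure := inferInstance
  support := by
    have h : 1 ≤ ‖shift fun _ => 1‖ := by
      have := (shift fun _ => 1).le_opNorm (basisVec 0)
      rwa [shift, weightedTranslation_basisVec (add_left_injective 1) bounded_one, norm_smul,
        norm_basisVec, norm_basisVec, Complex.ofReal_one, norm_one, mul_one, mul_one] at this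
    rw [← mem_ae_iff, ae_dirac_eq]
    exact ⟨zero_le_one, one_le_pow₀ h⟩
  moments k := by simp

end Parameters

/-- In the second part, `ω₁²/4 < x₀²` follows from `0 < a < 2x₀ - ω₁`. -/
theorem symmetricShift_spec {ω : ℕ → ℝ} {ξ : Measure ℝ} {ρ : ℝ} (hω : ∀ n, 0 < ω n)
    (hb : BddAbove (Set.range ω)) (hξ : IsBergerMeasure ω ξ) (h0 : ξ {0} = 0)
    (hi : Integrable (fun s : ℝ => 1 / s) ξ) (hρ : ρ = ∫ s, 1 / s ∂ξ) (h : ω 1 ^ 2 * ρ < 2) :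
    (∃ x₀ a : ℝ, 0 < x₀ ∧ ω 1 ^ 2 / 4 < x₀ ^ 2 ∧ x₀ ^ 2 ≤ 1 / (2 * ρ) ∧
      0 < a ∧ a < 2 * x₀ - ω 1) ∧
    (∀ x₀ a : ℝ, 0 < x₀ → x₀ ^ 2 ≤ 1 / (2 * ρ) → 0 < a → a < 2 * x₀ - ω 1 →
      IsSubnormal (shift (backwardExt x₀ ω)) ∧
      IsSubnormal (shift (backwardExt a ω)) ∧
      Commute (symmetricShift x₀ a ω 0) (symmetricShift x₀ a ω 1) ∧
      IsSubnormalTuple (symmetricShift x₀ a ω) ∧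
      Commute (toralAluthge (symmetricShift x₀ a ω) 0)
        (toralAluthge (symmetricShift x₀ a ω) 1) ∧
      ¬ IsJointlyHyponormal (toralAluthge (symmetricShift x₀ a ω))) := by
  have hb' := bounded_of_bddAbove hω hb
  obtain ⟨h1, h2⟩ := one_le_sq_mul_and_weight_le hω hξ h0 hi
  rw [← hρ] at h1
  have hρ0 : 0 < ρ := pos_of_mul_pos_right (one_pos.trans_le h1) (sq_nonneg _)
  refine ⟨exists_parameters hρ0 h, fun x₀ a hx₀ hx ha hax => ?_⟩
  obtain ⟨hx₀ρ, haρ⟩ := parameter_bounds hω hρ0 h1 h2 hx ha hax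
  rw [hρ] at hx₀ρ haρ
  have hsub := isSubnormalTuple_symmetricShift hω hb' hξ h0 hi hx₀ ha hx₀ρ haρ
  exact ⟨isSubnormal_shift_row (bounded_rowWeights hb') hsub 0,
    isSubnormal_shift_row (bounded_rowWeights hb') hsub 1, commute_symmetricShift hb', hsub,
    commute_toralAluthge_symmetricShift hb' hω hx₀ ha,
    not_isJointlyHyponormal_toralAluthge_symmetricShift hb' hω hx₀ ha hax⟩

end

end AluthgeShift

theorem theorem3p10 :
    -- the family of subnormal shifts with non-hyponormal toral Aluthge transform
    (∀ (ω : ℕ → ℝ) (ξ : Measure ℝ) (ρ : ℝ),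
      (∀ n, 0 < ω n) → BddAbove (Set.range ω) → IsBergerMeasure ω ξ →
      ξ {0} = 0 → Integrable (fun s : ℝ => 1 / s) ξ → ρ = ∫ s, 1 / s ∂ξ →
      ω 1 ^ 2 * ρ < 2 →
      (∃ x₀ a : ℝ, 0 < x₀ ∧ ω 1 ^ 2 / 4 < x₀ ^ 2 ∧ x₀ ^ 2 ≤ 1 / (2 * ρ) ∧
        0 < a ∧ a < 2 * x₀ - ω 1) ∧
      (∀ x₀ a : ℝ, 0 < x₀ → ω 1 ^ 2 / 4 < x₀ ^ 2 → x₀ ^ 2 ≤ 1 / (2 * ρ) →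
        0 < a → a < 2 * x₀ - ω 1 →
        IsSubnormal (shift (backwardExt x₀ ω)) ∧
        IsSubnormal (shift (backwardExt a ω)) ∧
        Commute (symmetricShift x₀ a ω 0) (symmetricShift x₀ a ω 1) ∧
        IsSubnormalTuple (symmetricShift x₀ a ω) ∧
        Commute (toralAluthge (symmetricShift x₀ a ω) 0)
          (toralAluthge (symmetricShift x₀ a ω) 1) ∧
        ¬ IsJointlyHyponormal (toralAluthge (symmetricShift x₀ a ω)))) ∧
    -- the toral Aluthge transform does not preserve hyponormality of 2-variable weighted shifts
    (∃ α β : ℕ × ℕ → ℝ,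
      (∀ k, 0 < α k) ∧ (∀ k, 0 < β k) ∧
      BddAbove (Set.range α) ∧ BddAbove (Set.range β) ∧
      Commute (shift₂ α β 0) (shift₂ α β 1) ∧
      IsSubnormalTuple (shift₂ α β) ∧ IsJointlyHyponormal (shift₂ α β) ∧
      Commute (toralAluthge (shift₂ α β) 0) (toralAluthge (shift₂ α β) 1) ∧
      ¬ IsJointlyHyponormal (toralAluthge (shift₂ α β))) ∧
    -- the one-variable Aluthge transform preserves hyponormality of weighted shifts
    (∀ ω : ℕ → ℝ, (∀ n, 0 < ω n) → BddAbove (Set.range ω) →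
      IsHyponormal (shift ω) → IsHyponormal (aluthge (shift ω))) := by
  refine ⟨fun ω ξ ρ hω hb hξ h0 hi hρ h => ?_, ?_, fun ω hω hb hhyp =>
    isHyponormal_aluthge_shift hω (bounded_of_bddAbove hω hb) hhyp⟩
  · obtain ⟨hex, hall⟩ := symmetricShift_spec hω hb hξ h0 hi hρ h
    exact ⟨hex, fun x₀ a hx₀ _ hx ha hax => hall x₀ a hx₀ hx ha hax⟩
  · -- the unweighted core: `ω = 1`, `ξ = δ₁`, `ρ = 1`
    have hω (n : ℕ) : 0 < (fun _ => 1 : ℕ → ℝ) n := one_pos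
    have hb : BddAbove (Set.range (fun _ => 1 : ℕ → ℝ)) := ⟨1, by simp [upperBounds]⟩
    obtain ⟨⟨x₀, a, hx₀, _, hx, ha, hax⟩, hall⟩ := symmetricShift_spec (ρ := 1) hω hb
      isBergerMeasure_dirac_one (by simp) (integrable_dirac (by simp)) (by simp) (by norm_num)
    obtain ⟨_, _, hcomm, hsub, hcomm', hnot⟩ := hall x₀ a hx₀ hx ha hax
    have hbdd : BddAbove (Set.range (rowWeights x₀ a fun _ => 1)) := by
      obtain ⟨C, hC⟩ := bounded_rowWeights (x₀ := x₀) (a := a) (bounded_of_bddAbove hω hb)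
      exact ⟨C, by rintro _ ⟨k, rfl⟩; exact (le_abs_self _).trans (hC k)⟩
    exact ⟨rowWeights x₀ a fun _ => 1, fun k => rowWeights x₀ a (fun _ => 1) k.swap,
      rowWeights_pos hx₀ ha hω, fun k => rowWeights_pos hx₀ ha hω k.swap, hbdd,
      hbdd.mono (by rintro _ ⟨k, rfl⟩; exact ⟨k.swap, rfl⟩), hcomm, hsub,
      hsub.isJointlyHyponormal, hcomm', hnot⟩
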